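/- Let $k$ be a commutative Noetherian ring and $m \geq 1$ an integer. Let $\mathrm{FI}$ be the category whose objects are the finite sets $[n]=\{1,\dots,n\}$, $n\ge 0$, and whose morphisms are the injections, and let $\mathrm{FI}^m$ be its $m$-fold product; its objects are the vectors $\mathbf n\in\mathbb N^m$. An $\mathrm{FI}^m$-module is a functor $V$ from $\mathrm{FI}^m$ to $k$-modules; write $V_{\mathbf n}$ for its value at $\mathbf n$. For $\mathbf r\in\mathbb N^m$, put $\mathfrak S_{\mathbf r}=\mathfrak S_{r_1}\times\cdots\times\mathfrak S_{r_m}$. For a $k[\mathfrak S_{\mathbf r}]$-module $W$, the induced module $M(W)$ is given by $M(W)_{\mathbf n}=k[\mathrm{Hom}_{\mathrm{FI}^m}(\mathbf r,\mathbf n)]\otimes_{k[\mathfrak S_{\mathbf r}]}W$, with morphisms of $\mathrm{FI}^m$ acting by composition on the left factor. An $\mathrm{FI}^m$-module $V$ is semi-induced if it has a finite filtration $0=V_0\subseteq V_1\subseteq\cdots\subseteq V_l=V$ by submodules such that every quotient $V_{i+1}/V_i$ is isomorphic to an induced module $M(W_i)$ (where $\mathbf r$ may depend on $i$). An element $v\in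 V_{\mathbf n}$ is $B$-torsion if it is killed by the map induced by some morphism $f_1\times\cdots\times f_m$ out of $\mathbf n$ for which at least one $f_j$ is not invertible. The $B$-torsion elements form a submodule $V_T\subseteq V$; the functor $V\mapsto V_T$ is left exact, and $H^i_B$ denotes its $i$-th right derived functor. If $V$ is a semi-induced $\mathrm{FI}^m$-module, then $H^i_B(V)=0$ for all $i\geq 0$. -/

import Mathlib

open CategoryTheory CategoryTheory.Limits

set_option maxSynthPendingDepth 3

universe u

/-- The category `FI`: an object is a natural number `n`, standing for the finite set
`[n]` with `n` elements. -/
structure FI : Type where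
  /-- the number of elements -/
  n : ℕ

namespace FI

/-- Morphisms of `FI` are the injections. -/
instance : SmallCategory FI where
  Hom a b := Fin a.n ↪ Fin b.n
  id a := Function.Embedding.refl _
  comp f g := Function.Embedding.trans f g

/-- The underlying injection of a morphism of `FI`. -/
def emb {a b : FI} (f : a ⟶ b) : Fin a.n ↪ Fin b.n := f

theorem comp_emb {a b c : FI} (f : a ⟶ b) (g : b ⟶ c) (x : Fin a.n) :
    emb (f ≫ g) x = emb g (emb f x) := rfl

theorem hom_ext {a b : FI} {f g : a ⟶ b} (h : ∀ x, emb f x = emb g x) : f = g :=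
  Function.Embedding.ext h

theorem le_of_hom {a b : FI} (f : a ⟶ b) : a.n ≤ b.n := by
  simpa using Fintype.card_le_of_embedding (emb f)

theorem isIso_of_le {a b : FI} (f : a ⟶ b) (h : b.n ≤ a.n) : IsIso f := by
  have hbij : Function.Bijective (emb f) :=
    (Fintype.bijective_iff_injective_and_card _).2
      ⟨(emb f).injective, by simpa using le_antisymm (le_of_hom f) h⟩
  refine ⟨⟨(Equiv.ofBijective _ hbij).symm.toEmbedding, ?_, ?_⟩⟩
  · exact hom_ext fun x => (Equiv.ofBijective _ hbij).symm_apply_apply x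
  · exact hom_ext fun x => (Equiv.ofBijective _ hbij).apply_symm_apply x

theorem not_isIso_of_lt {a b : FI} (f : a ⟶ b) (h : a.n < b.n) : ¬ IsIso f := fun _ =>
  absurd (le_of_hom (inv f)) (not_le.2 h)

theorem not_isIso_iff {a b : FI} (f : a ⟶ b) : ¬ IsIso f ↔ a.n < b.n :=
  ⟨fun h => not_le.1 fun h' => h (isIso_of_le f h'), not_isIso_of_lt f⟩

/-- Any two injections out of the same set can be completed to a commutative square whose
last corner has as many elements as the two given targets together. -/
theorem exists_square {a b c : FI} (f : a ⟶ b) (g : a ⟶ c) :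
    ∃ (f' : b ⟶ ⟨b.n + c.n⟩) (g' : c ⟶ ⟨b.n + c.n⟩), f ≫ f' = g ≫ g' := by
  classical
  let G : Fin c.n → Fin (b.n + c.n) := fun x =>
    if h : ∃ y, emb g y = x then Fin.castAdd c.n (emb f h.choose) else Fin.natAdd b.n x
  have hG : ∀ y, G (emb g y) = Fin.castAdd c.n (emb f y) := fun y => by
    have h : ∃ y', emb g y' = emb g y := ⟨y, rfl⟩
    have h2 : h.choose = y := (emb g).injective h.choose_spec
    simp only [G, dif_pos h, h2]
  have hinj : Function.Injective G := by
    intro x x' hx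
    by_cases h : ∃ y, emb g y = x <;> by_cases h' : ∃ y, emb g y = x'
    · obtain ⟨y, rfl⟩ := h
      obtain ⟨y', rfl⟩ := h'
      rw [hG, hG] at hx
      rw [(emb f).injective (Fin.castAdd_injective _ _ hx)]
    · obtain ⟨y, rfl⟩ := h
      rw [hG] at hx
      simp only [G, dif_neg h'] at hx
      have := congrArg Fin.val hx
      simp only [Fin.val_castAdd, Fin.val_natAdd] at this
      have := (emb f y).isLt
      omega
    · obtain ⟨y', rfl⟩ := h'
      rw [hG] at hx
      simp only [G, dif_neg h] at hx
      have := congrArg Fin.val hx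
      simp only [Fin.val_castAdd, Fin.val_natAdd] at this
      have := (emb f y').isLt
      omega
    · simp only [G, dif_neg h, dif_neg h'] at hx
      exact Fin.natAdd_injective _ _ hx
  refine ⟨Fin.castAddEmb c.n, ⟨G, hinj⟩, hom_ext fun y => ?_⟩
  exact (hG y).symm

end FI

/-- The `m`-fold product category of `FI` with itself. -/
abbrev FIPow (m : ℕ) : Type := Fin m → FI

/-- The category of `FI^m`-modules over `k`. -/
abbrev FIModule (k : Type u) [CommRing k] (m : ℕ) := FIPow m ⥤ ModuleCat.{u} k

namespace FIPow

variable {m : ℕ}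

/-- The product of symmetric groups `𝔖_r = 𝔖_{r_1} × ⋯ × 𝔖_{r_m}`. -/
abbrev SymGroup (r : FIPow m) : Type := ∀ j, Equiv.Perm (Fin (r j).n)

/-- An element of `𝔖_r`, as an endomorphism of `r` in `FI^m`. -/
def permHom {r : FIPow m} (σ : SymGroup r) : r ⟶ r :=
  fun j => (σ j).toEmbedding

/-- A morphism `f_1 × ⋯ × f_m` of `FI^m` induces transition maps if at least one `f_j` is
not invertible. -/
def IsTransition {a b : FIPow m} (f : a ⟶ b) : Prop := ∃ j, ¬ IsIso (f j)

theorem IsTransition.comp {a b c : FIPow m} {f : a ⟶ b} (hf : IsTransition f) (g : b ⟶ c) :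
    IsTransition (f ≫ g) := by
  obtain ⟨j, hj⟩ := hf
  exact ⟨j, FI.not_isIso_of_lt _
    (lt_of_lt_of_le ((FI.not_isIso_iff _).1 hj) (FI.le_of_hom (g j)))⟩

theorem exists_square {a b c : FIPow m} (f : a ⟶ b) (g : a ⟶ c) (hf : IsTransition f) :
    ∃ (d : FIPow m) (f' : b ⟶ d) (g' : c ⟶ d), f ≫ f' = g ≫ g' ∧ IsTransition g' := by
  choose f' g' h using fun j => FI.exists_square (f j) (g j)
  refine ⟨_, f', g', funext h, ?_⟩
  obtain ⟨j, hj⟩ := hf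
  refine ⟨j, FI.not_isIso_of_lt _ ?_⟩
  have := (FI.not_isIso_iff _).1 hj
  simp only
  omega

theorem exists_isTransition [NeZero m] (a : FIPow m) :
    ∃ (b : FIPow m) (f : a ⟶ b), IsTransition f :=
  ⟨fun j => ⟨(a j).n + 1⟩, fun _ => Fin.castSuccEmb, 0, FI.not_isIso_of_lt _ (Nat.lt_succ_self _)⟩

end FIPow

namespace FIModule

open FIPow

variable {k : Type u} [CommRing k] {m : ℕ}

/-! ### Induced and semi-induced modules -/

section Induced

open TensorProduct

variable {r : FIPow m} {W : Type u} [AddCommGroup W] [Module k W]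
  (ρ : Representation k (SymGroup r) W)

/-- The relations `fσ ⊗ w = f ⊗ σw` that turn `k[Hom(r, n)] ⊗_k W` into
`k[Hom(r, n)] ⊗_{k[𝔖_r]} W`. -/
noncomputable def inducedRel (n : FIPow m) : Submodule k (((r ⟶ n) →₀ k) ⊗[k] W) :=
  Submodule.span k
    {x | ∃ (f : r ⟶ n) (σ : SymGroup r) (w : W),
      x = Finsupp.single (permHom σ ≫ f) 1 ⊗ₜ[k] w - Finsupp.single f 1 ⊗ₜ[k] ρ σ w}

/-- Composition with `g : n ⟶ n'` on the left factor of `k[Hom(r, n)] ⊗_k W`. -/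
noncomputable def inducedMapAux (r : FIPow m) (W : Type u) [AddCommGroup W] [Module k W]
    {n n' : FIPow m} (g : n ⟶ n') :
    ((r ⟶ n) →₀ k) ⊗[k] W →ₗ[k] ((r ⟶ n') →₀ k) ⊗[k] W :=
  TensorProduct.map (Finsupp.lmapDomain k k fun f : r ⟶ n => f ≫ g) LinearMap.id

theorem inducedRel_le_comap {n n' : FIPow m} (g : n ⟶ n') :
    inducedRel ρ n ≤ (inducedRel ρ n').comap (inducedMapAux r W g) := by
  refine Submodule.span_le.2 ?_
  rintro _ ⟨f, σ, w, rfl⟩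
  refine Submodule.subset_span ⟨f ≫ g, σ, w, ?_⟩
  simp [inducedMapAux, Finsupp.mapDomain_single]

/-- The induced `FI^m`-module `M(W)`, with `M(W)_n = k[Hom(r, n)] ⊗_{k[𝔖_r]} W`. -/
noncomputable def induced : FIModule k m where
  obj n := ModuleCat.of k ((((r ⟶ n) →₀ k) ⊗[k] W) ⧸ inducedRel ρ n)
  map g := ModuleCat.ofHom (Submodule.mapQ _ _ (inducedMapAux r W g) (inducedRel_le_comap ρ g))
  map_id n := by
    ext : 1
    refine Submodule.linearMap_qext _ (TensorProduct.ext' fun x w => ?_)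
    have h : (fun f : r ⟶ n => f) = id := rfl
    simp [inducedMapAux, h]
  map_comp g h := by
    ext : 1
    refine Submodule.linearMap_qext _ (TensorProduct.ext' fun x w => ?_)
    simp [inducedMapAux, ← Finsupp.mapDomain_comp, Function.comp_def]

end Induced

/-- `V` is isomorphic to `M(W)` for some `r` and some `k[𝔖_r]`-module `W`. -/
def IsInduced (V : FIModule k m) : Prop :=
  ∃ (r : FIPow m) (W : Type u) (_ : AddCommGroup W) (_ : Module k W)
    (ρ : Representation k (SymGroup r) W), Nonempty (V ≅ induced ρ)

/-- `V` admits a finite filtration `0 = V_0 ⊆ V_1 ⊆ ⋯ ⊆ V_l = V` each of whose quotients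
`V_{i+1} / V_i` is isomorphic to an induced module. -/
def IsSemiInduced (V : FIModule k m) : Prop :=
  ∃ (l : ℕ) (F : Fin (l + 1) → Subobject V), F 0 = ⊥ ∧ F (Fin.last l) = ⊤ ∧
    ∀ i : Fin l, ∃ h : F i.castSucc ≤ F i.succ,
      IsInduced (cokernel (Subobject.ofLE (F i.castSucc) (F i.succ) h))

/-! ### The `B`-torsion functor and local cohomology -/

/-- An element of `V_n` is `B`-torsion if some transition map out of `V_n` kills it. -/
def IsTorsionElt (V : FIModule k m) (n : FIPow m) (v : V.obj n) : Prop :=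
  ∃ (r : FIPow m) (f : n ⟶ r), IsTransition f ∧ V.map f v = 0

theorem IsTorsionElt.map {V : FIModule k m} {n n' : FIPow m} {v : V.obj n}
    (hv : IsTorsionElt V n v) (g : n ⟶ n') : IsTorsionElt V n' (V.map g v) := by
  obtain ⟨r, f, hf, h0⟩ := hv
  obtain ⟨d, f', g', hsq, hg'⟩ := FIPow.exists_square f g hf
  refine ⟨d, g', hg', ?_⟩
  rw [← ModuleCat.comp_apply, ← V.map_comp, ← hsq, V.map_comp, ModuleCat.comp_apply, h0, map_zero]

theorem IsTorsionElt.app {V V' : FIModule k m} (φ : V ⟶ V') {n : FIPow m} {v : V.obj n}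
    (hv : IsTorsionElt V n v) : IsTorsionElt V' n (φ.app n v) := by
  obtain ⟨r, f, hf, h0⟩ := hv
  refine ⟨r, f, hf, ?_⟩
  rw [← ModuleCat.comp_apply, ← φ.naturality, ModuleCat.comp_apply, h0, map_zero]

variable [NeZero m]

/-- The `B`-torsion elements of `V_n`. -/
def torsionSubmodule (V : FIModule k m) (n : FIPow m) : Submodule k (V.obj n) where
  carrier := {v | IsTorsionElt V n v}
  zero_mem' := by
    obtain ⟨b, f, hf⟩ := exists_isTransition n
    exact ⟨b, f, hf, map_zero _⟩
  add_mem' := by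
    rintro v w ⟨b, f, hf, hv⟩ ⟨c, g, hg, hw⟩
    obtain ⟨d, f', g', hsq, -⟩ := FIPow.exists_square f g hf
    refine ⟨d, f ≫ f', hf.comp f', ?_⟩
    rw [map_add]
    nth_rewrite 2 [hsq]
    rw [V.map_comp, V.map_comp, ModuleCat.comp_apply, ModuleCat.comp_apply, hv, hw, map_zero,
      map_zero, add_zero]
  smul_mem' := by
    rintro c v ⟨b, f, hf, hv⟩
    exact ⟨b, f, hf, by rw [map_smul, hv, smul_zero]⟩

/-- The submodule `V_T` of `V` formed by its `B`-torsion elements. -/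
def torsion (V : FIModule k m) : FIModule k m where
  obj n := ModuleCat.of k (torsionSubmodule V n)
  map g := ModuleCat.ofHom ((V.map g).hom.restrict fun _ hv => IsTorsionElt.map hv g)
  map_id n := by
    ext x
    exact ConcreteCategory.congr_hom (V.map_id n) x.1
  map_comp g h := by
    ext x
    exact ConcreteCategory.congr_hom (V.map_comp g h) x.1

variable (k m)

/-- The `B`-torsion functor `V ↦ V_T`. -/
def torsionFunctor : FIModule k m ⥤ FIModule k m where
  obj V := torsion V
  map φ :=
    { app := fun n => ModuleCat.ofHom ((φ.app n).hom.restrict fun _ hv => IsTorsionElt.app φ hv)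
      naturality := fun n n' g => by
        ext x
        exact Subtype.ext (ConcreteCategory.congr_hom (φ.naturality g) x.1) }
  map_id V := by
    ext n x
    exact Subtype.ext rfl
  map_comp φ ψ := by
    ext n x
    exact Subtype.ext rfl

instance : (torsionFunctor k m).Additive where
  map_add := by
    intro V V' φ ψ
    ext n x
    exact Subtype.ext rfl

/-- The category of `FI^m`-modules is a Grothendieck abelian category, so it has enough
injectives. -/
instance isGrothendieckAbelian (k : Type u) [CommRing k] (m : ℕ) :
    IsGrothendieckAbelian.{u} (FIModule k m) := by
  have : HasCoproducts.{0} (ModuleCat.{u} k) := hasCoproducts_shrink.{0, u}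
  have : HasSeparator (FIModule k m) :=
    HasSeparator.of_equivalence
      ((opOpEquivalence (FIPow m)).congrLeft (E := ModuleCat.{u} k))
  have : AB5OfSize.{u, u} (FIModule k m) := ⟨fun _ _ _ => inferInstance⟩
  exact { }

/-- The `i`-th local cohomology functor `H^i_B`, the `i`-th right derived functor of the
`B`-torsion functor. -/
noncomputable def localCohomology (i : ℕ) : FIModule k m ⥤ FIModule k m :=
  (torsionFunctor k m).rightDerived i

end FIModule

/-! The proof compares a module `V` with its shift `S V`, where `(S V)_n = V_{n + (1, …, 1)}`,
through the natural map `η : V ⟶ S V` given by the inclusions that miss the new points.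

For an induced module `η` is a split monomorphism: send a basis morphism that misses all the new
points to itself and every other one to zero (`retraction`). The shift is exact, preserves
injectives and commutes with the torsion functor, so it commutes with `H^i_B`, and the splitting
makes `η` a monomorphism at `H^i_B(V)` (`mono_app_rightDerived`). A module on which `η` is a
monomorphism is torsion-free, since each element survives to arbitrarily large objects
(`eq_zero_of_isTorsionElt`). But `H^i_B(V)` is a subquotient of a torsion module, hence torsion
(`isTorsionElt_localCohomology`). Being both, it is zero.

The semi-induced case follows by induction along the filtration: for a left exact functor, vanishing
of the `i`-th derived functor at the two ends of a short exact sequence gives vanishing in the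
middle (`isZero_rightDerived_X₂`). -/

namespace CategoryTheory

universe v₁ v₂ u₁ u₂

variable {C : Type u₁} [Category.{v₁} C] [Abelian C] {D : Type u₂} [Category.{v₂} D] [Abelian D]

/-! ### Injective resolutions and vanishing of right derived functors. -/

namespace InjectiveResolution

/-- The augmentation `Z ⟶ I⁰` of an injective resolution. -/
noncomputable def augmentation {Z : C} (I : InjectiveResolution Z) : Z ⟶ I.cocomplex.X 0 := I.ι.f 0

theorem augmentation_comp_d {Z : C} (I : InjectiveResolution Z) :
    I.augmentation ≫ I.cocomplex.d 0 1 = 0 := I.ι_f_zero_comp_complex_d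

theorem exact_augmentation {Z : C} (I : InjectiveResolution Z) :
    (ShortComplex.mk _ _ I.augmentation_comp_d).Exact := I.exact₀

instance {Z : C} (I : InjectiveResolution Z) : Mono I.augmentation :=
  inferInstanceAs (Mono (I.ι.f 0))

/-- An exact complex of injective objects `0 ⟶ Z ⟶ K⁰ ⟶ K¹ ⟶ ⋯` is an injective resolution. -/
noncomputable def ofExact {Z : C} (K : CochainComplex C ℕ)
    (hK : ∀ n, Injective (K.X n)) (f : Z ⟶ K.X 0) (w : f ≫ K.d 0 1 = 0) (hf : Mono f)
    (h₀ : (ShortComplex.mk f (K.d 0 1) w).Exact) (h : ∀ n, K.ExactAt (n + 1)) :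
    InjectiveResolution Z where
  cocomplex := K
  injective := hK
  ι := (CochainComplex.fromSingle₀Equiv _ _).symm ⟨f, w⟩
  quasiIso := ⟨fun n => by
    cases n
    · rw [CochainComplex.quasiIsoAt₀_iff, ShortComplex.quasiIso_iff_of_zeros]
      · refine (ShortComplex.exact_and_mono_f_iff_of_iso ?_).2 ⟨h₀, hf⟩
        refine ShortComplex.isoMk (Iso.refl _) (Iso.refl _) (Iso.refl _) ?_ ?_
        · exact (Category.id_comp _).trans
            ((CochainComplex.fromSingle₀Equiv_symm_apply_f_zero (C := K) f w).symm.trans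
              (Category.comp_id _).symm)
        · exact (Category.id_comp _).trans (Category.comp_id _).symm
      · rfl
      · rfl
      · exact K.shape _ _ (by simp)
    · rw [quasiIsoAt_iff_exactAt]
      · exact h _
      · exact CochainComplex.exactAt_succ_single_obj _ _⟩

theorem augmentation_ofExact {Z : C} (K : CochainComplex C ℕ)
    (hK : ∀ n, Injective (K.X n)) (f : Z ⟶ K.X 0) (w : f ≫ K.d 0 1 = 0) (hf : Mono f)
    (h₀ : (ShortComplex.mk f (K.d 0 1) w).Exact) (h : ∀ n, K.ExactAt (n + 1)) :
    (ofExact K hK f w hf h₀ h).augmentation = f :=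
  CochainComplex.fromSingle₀Equiv_symm_apply_f_zero _ _

theorem isZero_rightDerived_iff [HasInjectiveResolutions C] {Z : C}
    (I : InjectiveResolution Z) (F : C ⥤ D) [F.Additive] (n : ℕ) :
    IsZero ((F.rightDerived n).obj Z) ↔
      ((F.mapHomologicalComplex (ComplexShape.up ℕ)).obj I.cocomplex).ExactAt n := by
  rw [(I.isoRightDerivedObj F n).isZero_iff]
  exact (HomologicalComplex.exactAt_iff_isZero_homology _ _).symm

theorem isZero_rightDerived_succ_iff [HasInjectiveResolutions C] {Z : C}
    (I : InjectiveResolution Z) (F : C ⥤ D) [F.Additive] (n : ℕ) :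
    IsZero ((F.rightDerived (n + 1)).obj Z) ↔
      (ShortComplex.mk (F.map (I.cocomplex.d n (n + 1))) (F.map (I.cocomplex.d (n + 1) (n + 2)))
        (by rw [← F.map_comp, I.cocomplex.d_comp_d, F.map_zero])).Exact := by
  rw [I.isZero_rightDerived_iff, HomologicalComplex.exactAt_iff' _ n (n + 1) (n + 2) (by simp)
    (by simp only [CochainComplex.next]; rfl)]
  rfl

end InjectiveResolution

/-! ### Dimension shifting and vanishing in the middle of a short exact sequence. -/

namespace ShortComplex.ShortExact

variable {S : ShortComplex C}

/-- An injective resolution of the cokernel of `Z ⟶ I`, `I` injective, extends to one of `Z`. -/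
theorem exists_injectiveResolution (hS : S.ShortExact) (h₂ : Injective S.X₂)
    (J : InjectiveResolution S.X₃) :
    ∃ I : InjectiveResolution S.X₁, I.cocomplex = CochainComplex.augment J.cocomplex
      (S.g ≫ J.augmentation)
      (by rw [Category.assoc, J.augmentation_comp_d, comp_zero]) := by
  have := hS.epi_g
  refine ⟨InjectiveResolution.ofExact _ ?_ S.f ?_ hS.mono_f ?_ ?_, rfl⟩
  · rintro (_ | n)
    · exact h₂
    · exact J.injective n
  · exact (S.zero_assoc _).trans zero_comp
  -- The augmentation of `J` is a monomorphism, so following `S.g` by it does not change the kernel.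
  · refine (ShortComplex.exact_iff_of_epi_of_isIso_of_mono (S₁ := S)
      (S₂ := ShortComplex.mk S.f (S.g ≫ J.augmentation) (by simp))
      ⟨𝟙 _, 𝟙 _, J.augmentation, by simp, by simp⟩).1 hS.exact
  · rintro (_ | n)
    · rw [HomologicalComplex.exactAt_iff' _ 0 1 2 (by simp) (by simp)]
      exact (ShortComplex.exact_iff_of_epi_of_isIso_of_mono
        (S₁ := ShortComplex.mk (S.g ≫ J.augmentation) (J.cocomplex.d 0 1)
          (by rw [Category.assoc, J.augmentation_comp_d, comp_zero]))
        (S₂ := ShortComplex.mk J.augmentation (J.cocomplex.d 0 1) J.augmentation_comp_d)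
        ⟨S.g, 𝟙 _, 𝟙 _, by simp, by simp⟩).2 J.exact_augmentation
    · rw [HomologicalComplex.exactAt_iff' _ (n + 1) (n + 2) (n + 3) (by simp)
        (by simp only [CochainComplex.next]; rfl)]
      exact J.exact_succ n

variable (F : C ⥤ D) [F.Additive]

/-- Dimension shifting. -/
theorem isZero_rightDerived_add_two_iff [HasInjectiveResolutions C] (hS : S.ShortExact)
    (h₂ : Injective S.X₂) (n : ℕ) :
    IsZero ((F.rightDerived (n + 2)).obj S.X₁) ↔ IsZero ((F.rightDerived (n + 1)).obj S.X₃) := by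
  let J := injectiveResolution S.X₃
  obtain ⟨I, hI⟩ := hS.exists_injectiveResolution h₂ J
  rw [I.isZero_rightDerived_iff, hI, J.isZero_rightDerived_succ_iff,
    HomologicalComplex.exactAt_iff' _ (n + 1) (n + 2) (n + 3) (by simp)
      (by simp only [CochainComplex.next]; rfl)]
  rfl

/-- Dimension shifting in its lowest degree. Left exactness identifies the 1-cocycles with `F.obj
S.X₃`, so the first derived functor at `S.X₁` is the cokernel of `F.map S.g`. -/
theorem isZero_rightDerived_one_iff [HasInjectiveResolutions C] [PreservesFiniteLimits F]
    (hS : S.ShortExact) (h₂ : Injective S.X₂) :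
    IsZero ((F.rightDerived 1).obj S.X₁) ↔ Epi (F.map S.g) := by
  let J := injectiveResolution S.X₃
  obtain ⟨I, hI⟩ := hS.exists_injectiveResolution h₂ J
  rw [I.isZero_rightDerived_iff, hI, HomologicalComplex.exactAt_iff' _ 0 1 2 (by simp) (by simp)]
  have hF : PreservesFiniteLimits F ↔
      ∀ S : ShortComplex C, S.Exact ∧ Mono S.f → (S.map F).Exact ∧ Mono (F.map S.f) :=
    (Functor.preservesFiniteLimits_tfae F).out 3 1
  have hJ := hF.1 inferInstance _ ⟨J.exact_augmentation, inferInstance⟩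
  have : Mono (F.map J.augmentation) := hJ.2
  have hJ₁ : (ShortComplex.mk (F.map J.augmentation) (F.map (J.cocomplex.d 0 1))
    (by rw [← F.map_comp, J.augmentation_comp_d, F.map_zero])).Exact := hJ.1
  have e : F.map (S.g ≫ J.augmentation) ≫ F.map (J.cocomplex.d 0 1) = 0 := by
    rw [← F.map_comp, Category.assoc, J.augmentation_comp_d, comp_zero, F.map_zero]
  have key : (ShortComplex.mk (F.map (S.g ≫ J.augmentation)) (F.map (J.cocomplex.d 0 1)) e).Exact ↔
      Epi (F.map S.g) := by
    constructor
    · intro h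
      rw [epi_iff_surjective_up_to_refinements]
      intro A a
      obtain ⟨A', π, hπ, x, hx⟩ := h.exact_up_to_refinements (a ≫ F.map J.augmentation) (by
        simp only [Category.assoc, ← F.map_comp, J.augmentation_comp_d, F.map_zero, comp_zero])
      refine ⟨A', π, hπ, x, ?_⟩
      rw [← cancel_mono (F.map J.augmentation)]
      simpa using hx
    · intro h
      refine (ShortComplex.exact_iff_of_epi_of_isIso_of_mono
        (S₁ := ShortComplex.mk (F.map (S.g ≫ J.augmentation)) (F.map (J.cocomplex.d 0 1)) e)
        (S₂ := ShortComplex.mk (F.map J.augmentation) (F.map (J.cocomplex.d 0 1)) _)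
        ⟨F.map S.g, 𝟙 _, 𝟙 _, by simp, by simp⟩).2 hJ₁
  exact key

/-- The first step of the horseshoe construction: a short exact sequence embeds into a split short
exact sequence of injective objects, with short exact quotient. -/
theorem exists_injective_embedding [EnoughInjectives C] (hS : S.ShortExact) :
    ∃ (T Q : ShortComplex C) (α : S ⟶ T) (β : T ⟶ Q) (w : α ≫ β = 0),
      Nonempty T.Splitting ∧ Q.ShortExact ∧
      Injective T.X₁ ∧ Injective T.X₂ ∧ Injective T.X₃ ∧
      (ShortComplex.mk α.τ₁ β.τ₁ (congrArg Hom.τ₁ w)).ShortExact ∧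
      (ShortComplex.mk α.τ₂ β.τ₂ (congrArg Hom.τ₂ w)).ShortExact ∧
      (ShortComplex.mk α.τ₃ β.τ₃ (congrArg Hom.τ₃ w)).ShortExact := by
  have := hS.mono_f
  have := hS.epi_g
  let I := Injective.under S.X₁
  let J := Injective.under S.X₃
  let T : ShortComplex C := ShortComplex.mk (biprod.inl : I ⟶ I ⊞ J) biprod.snd (by simp)
  have hT : T.Splitting := ShortComplex.Splitting.ofHasBinaryBiproduct I J
  let s : S.X₂ ⟶ I := Injective.factorThru (Injective.ι S.X₁) S.f
  have hs : S.f ≫ s = Injective.ι S.X₁ := Injective.comp_factorThru _ _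
  let α : S ⟶ T :=
    { τ₁ := Injective.ι S.X₁
      τ₂ := biprod.lift s (S.g ≫ Injective.ι S.X₃)
      τ₃ := Injective.ι S.X₃
      comm₁₂ := by ext <;> simp [T, hs]
      comm₂₃ := by simp [T] }
  have m₁ : Mono α.τ₁ := inferInstanceAs (Mono (Injective.ι S.X₁))
  have m₃ : Mono α.τ₃ := inferInstanceAs (Mono (Injective.ι S.X₃))
  have m₂ : Mono α.τ₂ := by
    refine Preadditive.mono_of_cancel_zero _ fun x hx => ?_
    have h₁ : x ≫ s = 0 := by simpa [α] using congrArg (· ≫ biprod.fst) hx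
    have h₂ : x ≫ S.g = 0 := by
      rw [← cancel_mono (Injective.ι S.X₃)]
      simpa [α] using congrArg (· ≫ biprod.snd) hx
    have h₃ : hS.exact.lift x h₂ = 0 := by
      rw [← cancel_mono (Injective.ι S.X₁), ← hs, ← Category.assoc, hS.exact.lift_f, h₁, zero_comp]
    rw [← hS.exact.lift_f x h₂, h₃, zero_comp]
  let Sn : SnakeInput C :=
    { L₀ := kernel α
      L₁ := S
      L₂ := T
      L₃ := cokernel α
      v₀₁ := kernel.ι α
      v₁₂ := α
      v₂₃ := cokernel.π α
      h₀ := kernelIsKernel α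
      h₃ := cokernelIsCokernel α
      L₁_exact := hS.exact
      epi_L₁_g := hS.epi_g
      L₂_exact := hT.exact
      mono_L₂_f := hT.shortExact.mono_f }
  have : Epi Sn.L₂.g := hT.shortExact.epi_g
  -- In the snake sequence the kernel of `α.τ₃` precedes the cokernel of `α.τ₁`; its vanishing makes
  -- `Q.f` a monomorphism.
  have z : IsZero Sn.L₀.X₃ := by
    have : Sn.v₀₁.τ₃ = 0 := by
      have h : Mono Sn.v₁₂.τ₃ := m₃
      rw [← cancel_mono Sn.v₁₂.τ₃, Sn.w₀₂_τ₃, zero_comp]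
    have h := Sn.mono_v₀₁_τ₃
    exact IsZero.of_mono_eq_zero Sn.v₀₁.τ₃ this
  refine ⟨T, cokernel α, α, cokernel.π α, cokernel.condition α, ⟨hT⟩,
    { exact := Sn.L₃_exact, mono_f := ?_, epi_g := Sn.epi_L₃_g },
    inferInstanceAs (Injective I), inferInstanceAs (Injective (I ⊞ J)),
    inferInstanceAs (Injective J),
    { exact := Sn.exact_C₁_down, mono_f := m₁, epi_g := Sn.epi_v₂₃_τ₁ },
    { exact := Sn.exact_C₂_down, mono_f := m₂, epi_g := Sn.epi_v₂₃_τ₂ },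
    { exact := Sn.exact_C₃_down, mono_f := m₃, epi_g := Sn.epi_v₂₃_τ₃ }⟩
  exact Sn.L₂'_exact.mono_g (z.eq_of_src _ _)

/-- This replaces the long exact sequence. Degree zero is left exactness. A positive degree is
lowered by passing to the quotient `Q` of the sequence by its injective embedding; degree one
becomes a surjectivity statement, settled by a diagram chase. -/
theorem isZero_rightDerived_X₂ [EnoughInjectives C] [PreservesFiniteLimits F] (n : ℕ) :
    ∀ (S : ShortComplex C) (_ : S.ShortExact) (_ : IsZero ((F.rightDerived n).obj S.X₁))
      (_ : IsZero ((F.rightDerived n).obj S.X₃)), IsZero ((F.rightDerived n).obj S.X₂) := by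
  have hF := F.preservesFiniteLimits_iff_forall_exact_map_and_mono.1 inferInstance
  induction n with
  | zero =>
    intro S hS h₁ h₃
    rw [(F.rightDerivedZeroIsoSelf.app _).isZero_iff] at h₁ h₃ ⊢
    exact (hF S hS).1.isZero_of_both_zeros (h₁.eq_of_src _ _) (h₃.eq_of_tgt _ _)
  | succ n ih =>
    intro S hS h₁ h₃
    obtain ⟨T, Q, α, β, w, ⟨hT⟩, hQ, i₁, i₂, i₃, e₁, e₂, e₃⟩ := hS.exists_injective_embedding
    cases n with
    | zero =>
      replace h₁ := (e₁.isZero_rightDerived_one_iff F i₁).1 h₁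
      replace h₃ := (e₃.isZero_rightDerived_one_iff F i₃).1 h₃
      refine (e₂.isZero_rightDerived_one_iff F i₂).2 ?_
      dsimp at h₁ h₃ ⊢
      have hQF : (ShortComplex.mk (F.map Q.f) (F.map Q.g)
        (by rw [← F.map_comp, Q.zero, F.map_zero])).Exact := (hF Q hQ).1
      have hs : F.map hT.s ≫ F.map T.g = 𝟙 _ := by rw [← F.map_comp, hT.s_g, F.map_id]
      have c₁₂ : F.map β.τ₁ ≫ F.map Q.f = F.map T.f ≫ F.map β.τ₂ := by
        simp only [← F.map_comp, β.comm₁₂]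
      have c₂₃ : F.map β.τ₂ ≫ F.map Q.g = F.map T.g ≫ F.map β.τ₃ := by
        simp only [← F.map_comp, β.comm₂₃]
      rw [epi_iff_surjective_up_to_refinements]
      intro A q
      -- Chase as in the five lemma. The splitting of `T` stands in for surjectivity of `F.map T.g`:
      -- it carries the lift `t` into the middle term, and the remaining error comes from `F.obj
      -- Q.X₁`, where `F.map β.τ₁` is epi.
      obtain ⟨A₁, π₁, hπ₁, t, ht⟩ := surjective_up_to_refinements_of_epi (F.map β.τ₃)
        (q ≫ F.map Q.g)
      obtain ⟨A₂, π₂, hπ₂, a, ha⟩ := hQF.exact_up_to_refinements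
        (π₁ ≫ q - t ≫ F.map hT.s ≫ F.map β.τ₂) (by
          simp only [Preadditive.sub_comp, Category.assoc, ht, c₂₃, reassoc_of% hs, sub_self])
      obtain ⟨A₃, π₃, hπ₃, b, hb⟩ := surjective_up_to_refinements_of_epi (F.map β.τ₁) a
      refine ⟨A₃, π₃ ≫ π₂ ≫ π₁, inferInstance,
        b ≫ F.map T.f + π₃ ≫ π₂ ≫ t ≫ F.map hT.s, ?_⟩
      have ha' : π₂ ≫ π₁ ≫ q = a ≫ F.map Q.f + π₂ ≫ t ≫ F.map hT.s ≫ F.map β.τ₂ := by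
        rw [← sub_eq_iff_eq_add, ← Preadditive.comp_sub]
        exact ha
      simp only [Category.assoc, ha', Preadditive.add_comp, Preadditive.comp_add, ← c₁₂,
        reassoc_of% hb]
    | succ n =>
      rw [e₁.isZero_rightDerived_add_two_iff F i₁] at h₁
      rw [e₃.isZero_rightDerived_add_two_iff F i₃] at h₃
      rw [e₂.isZero_rightDerived_add_two_iff F i₂]
      exact ih Q hQ h₁ h₃

end ShortComplex.ShortExact

/-! ### Derived functors and exact functors that preserve injectives. -/

namespace InjectiveResolution

/-- The image of an injective resolution under an exact functor preserving injective objects. -/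
noncomputable def mapExact {Z : C} (I : InjectiveResolution Z) (G : C ⥤ D) [G.Additive]
    [PreservesFiniteLimits G] [PreservesFiniteColimits G] [G.PreservesInjectiveObjects] :
    InjectiveResolution (G.obj Z) :=
  ofExact ((G.mapHomologicalComplex _).obj I.cocomplex)
    (fun n => inferInstanceAs (Injective (G.obj (I.cocomplex.X n))))
    (G.map I.augmentation)
    (by
      change G.map I.augmentation ≫ G.map (I.cocomplex.d 0 1) = 0
      rw [← G.map_comp, I.augmentation_comp_d, G.map_zero])
    (inferInstanceAs (Mono (G.map I.augmentation)))
    (I.exact_augmentation.map G)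
    (fun n => by
      rw [HomologicalComplex.exactAt_iff' _ n (n + 1) (n + 2) (by simp)
        (by simp only [CochainComplex.next]; rfl)]
      exact (I.exact_succ n).map G)

theorem augmentation_mapExact {Z : C} (I : InjectiveResolution Z) (G : C ⥤ D) [G.Additive]
    [PreservesFiniteLimits G] [PreservesFiniteColimits G] [G.PreservesInjectiveObjects] :
    (I.mapExact G).augmentation = G.map I.augmentation :=
  augmentation_ofExact _ _ _ _ _ _ _

end InjectiveResolution

theorem mono_of_comp_iso_eq {C : Type u₁} [Category.{v₁} C] {A B A' B' : C} {f : A ⟶ B}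
    {g : A' ⟶ B'} (a : A ≅ A') (b : B ≅ B')
    (h : f ≫ b.hom = a.hom ≫ g) (hf : Mono f) : Mono g := by
  rw [← Iso.inv_comp_eq] at h
  rw [← h]
  infer_instance

/-- Let `G` be an exact functor that preserves injective objects, commutes with `F`, and receives a
natural transformation `η` from the identity. If `η` is a split monomorphism at `V`, then it is a
monomorphism at `RⁱF(V)`. -/
theorem mono_app_rightDerived [HasInjectiveResolutions C] (F : C ⥤ C) [F.Additive] (G : C ⥤ C)
    [G.Additive] [PreservesFiniteLimits G] [PreservesFiniteColimits G]
    [G.PreservesInjectiveObjects] (η : 𝟭 C ⟶ G) (e : G ⋙ F ≅ F ⋙ G)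
    (he : ∀ X, F.map (η.app X) ≫ e.hom.app X = η.app (F.obj X))
    (V : C) [IsSplitMono (η.app V)] (n : ℕ) : Mono (η.app ((F.rightDerived n).obj V)) := by
  let I := injectiveResolution V
  let J := I.mapExact G
  let K := I.cocomplex
  let FK := (F.mapHomologicalComplex (ComplexShape.up ℕ)).obj K
  let ψ : K ⟶ (G.mapHomologicalComplex _).obj K :=
    { f := fun i => η.app (K.X i)
      comm' := fun i j _ => (η.naturality (K.d i j)).symm }
  let θ : FK ⟶ (G.mapHomologicalComplex _).obj FK :=
    { f := fun i => η.app (F.obj (K.X i))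
      comm' := fun i j _ => (η.naturality (F.map (K.d i j))).symm }
  let ε : (F.mapHomologicalComplex (ComplexShape.up ℕ)).obj ((G.mapHomologicalComplex _).obj K) ≅
      (G.mapHomologicalComplex _).obj FK :=
    HomologicalComplex.Hom.isoOfComponents (fun i => e.app (K.X i))
      (fun i j _ => (e.hom.naturality (K.d i j)).symm)
  have hε : (F.mapHomologicalComplex _).map ψ ≫ ε.hom = θ := by
    ext i
    exact he (K.X i)
  have comm : I.ι.f 0 ≫ ψ.f 0 = η.app V ≫ J.ι.f 0 := by
    refine (η.naturality I.augmentation).trans ?_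
    exact congrArg (fun f : G.obj V ⟶ G.obj (K.X 0) => η.app V ≫ f) (I.augmentation_mapExact G).symm
  have hnat := InjectiveResolution.isoRightDerivedObj_hom_naturality (η.app V) I J ψ comm F n
  -- Any functor preserves split monomorphisms, in particular `F.rightDerived n`; this is where the
  -- splitting at `V` is needed.
  have m₁ : Mono (HomologicalComplex.homologyMap ((F.mapHomologicalComplex _).map ψ) n) :=
    mono_of_comp_iso_eq _ _ hnat inferInstance
  have m₂ : Mono (HomologicalComplex.homologyMap θ n) := by
    rw [← hε, HomologicalComplex.homologyMap_comp]
    infer_instance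
  -- Since `G` is exact it commutes with homology, and the map that `η` induces on homology is `η`
  -- at the homology object.
  have m₃ : Mono (η.app (FK.homology n)) := by
    have : Mono (ShortComplex.homologyMap ((FK.sc n).mapNatTrans η)) := m₂
    refine mono_of_comp_iso_eq ((FK.sc n).mapHomologyIso (𝟭 C)) ((FK.sc n).mapHomologyIso G) ?_ this
    exact (Iso.inv_comp_eq _).1 (NatTrans.app_homology η (FK.sc n)).symm
  exact mono_of_comp_iso_eq ((𝟭 C).mapIso (I.isoRightDerivedObj F n).symm)
    (G.mapIso (I.isoRightDerivedObj F n).symm) (η.naturality _).symm m₃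

end CategoryTheory

/-! ### The shift on `FI`. -/

namespace FI

/-- The functor `[n] ↦ [n + 1]`, adding a new element `0` fixed by all morphisms. -/
def shift : FI ⥤ FI where
  obj a := ⟨a.n + 1⟩
  map {a b} f :=
    (⟨Fin.cases 0 fun i => (emb f i).succ, by
      intro x y
      refine Fin.cases ?_ (fun x => ?_) x <;> refine Fin.cases ?_ (fun y => ?_) y
      · simp
      · simpa using fun h => (Fin.succ_ne_zero _ h.symm).elim
      · simp
      · simp⟩ : Fin (a.n + 1) ↪ Fin (b.n + 1))
  map_id a := hom_ext fun x => by
    refine Fin.cases ?_ (fun x => ?_) x <;> rfl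
  map_comp f g := hom_ext fun x => by
    refine Fin.cases ?_ (fun x => ?_) x <;> rfl

/-- The inclusion `[n] ⟶ [n + 1]` missing the new element. -/
def unit : 𝟭 FI ⟶ shift where
  app a := Fin.succEmb a.n
  naturality _ _ _ := hom_ext fun _ => rfl

/-- The new element of `[n + 1]`. -/
def base (a : FI) : Fin (shift.obj a).n := (0 : Fin (a.n + 1))

theorem emb_shift_map_base {a b : FI} (f : a ⟶ b) :
    emb (shift.map f) (base a) = base b := rfl

instance (a : FI) : Mono (unit.app a) where
  right_cancellation f g h := hom_ext fun x => Fin.succ_injective _ <| by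
    have := congrArg (fun φ => emb φ x) h
    exact this

instance : shift.Faithful where
  map_injective {a b f g} h := hom_ext fun x => Fin.succ_injective _ <| by
    have := congrArg (fun φ => emb φ (Fin.succ x)) h
    exact this

theorem exists_shift_map_eq {a b : FI} (h : shift.obj a ⟶ shift.obj b)
    (h₀ : emb h (base a) = base b) : ∃ g, shift.map g = h := by
  have hne (i : Fin a.n) : emb h i.succ ≠ base b := fun hi =>
    Fin.succ_ne_zero i ((emb h).injective (hi.trans h₀.symm))
  refine ⟨(⟨fun i => Fin.pred _ (hne i), fun i j hij => ?_⟩ : Fin a.n ↪ Fin b.n),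
    hom_ext fun x => ?_⟩
  · exact Fin.succ_injective _ ((emb h).injective (Fin.pred_inj.1 hij))
  · refine Fin.cases h₀.symm (fun i => ?_) x
    exact Fin.succ_pred _ (hne i)

theorem exists_shift_map_comp_eq {a b x : FI} (φ : shift.obj b ⟶ x) [IsIso φ]
    (ψ : shift.obj a ⟶ x) (h : emb ψ (base a) = emb φ (base b)) :
    ∃ g, shift.map g ≫ φ = ψ := by
  obtain ⟨g, hg⟩ := exists_shift_map_eq (ψ ≫ inv φ) (by
    apply (emb φ).injective
    rw [← comp_emb, Category.assoc, IsIso.inv_hom_id, Category.comp_id, h])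
  exact ⟨g, by rw [hg, Category.assoc, IsIso.inv_hom_id, Category.comp_id]⟩

theorem exists_comp_unit_iff {a b : FI} (f : a ⟶ shift.obj b) :
    (∃ g : a ⟶ b, g ≫ unit.app b = f) ↔ ∀ i, emb f i ≠ base b := by
  constructor
  · rintro ⟨g, rfl⟩ i
    exact Fin.succ_ne_zero _
  · intro hf
    exact ⟨(⟨fun i => Fin.pred _ (hf i), fun _ _ hij => (emb f).injective (Fin.pred_inj.1 hij)⟩ :
      Fin a.n ↪ Fin b.n), hom_ext fun i => Fin.succ_pred _ (hf i)⟩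

/-- `shift.map h` is injective and fixes the new element, so composing with it neither creates nor
destroys a hit on that element. This makes the retraction of induced modules natural. -/
theorem exists_comp_unit_comp_shift_map_iff {a b c : FI} (f : a ⟶ shift.obj b) (h : b ⟶ c) :
    (∃ g : a ⟶ c, g ≫ unit.app c = f ≫ shift.map h) ↔ ∃ g : a ⟶ b, g ≫ unit.app b = f := by
  rw [exists_comp_unit_iff, exists_comp_unit_iff]
  refine forall_congr' fun i => not_congr ?_
  rw [comp_emb, ← emb_shift_map_base h]
  exact (emb _).injective.eq_iff

theorem exists_isIso_shift {a : FI} (e : Fin a.n) :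
    ∃ (b : FI) (φ : shift.obj b ⟶ a), IsIso φ ∧ emb φ (base b) = e := by
  obtain ⟨_ | n⟩ := a
  · exact e.elim0
  · refine ⟨⟨n⟩, (Equiv.swap 0 e).toEmbedding, isIso_of_le _ le_rfl, ?_⟩
    exact Equiv.swap_apply_left 0 e

/-- An injection extends along another one, if the target is large enough. -/
theorem exists_comp_eq {a b c : FI} (f : a ⟶ b) (g : a ⟶ c) (h : b.n ≤ c.n) :
    ∃ g' : b ⟶ c, f ≫ g' = g := by
  -- Permutations of `[c]` act transitively on embeddings of `[a]`: embed `b` in `c` in the standard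
  -- way, then correct by a permutation.
  obtain ⟨σ, hσ⟩ := (Equiv.Perm.isMultiplyPretransitive (Fin c.n) a.n).exists_smul_eq
    ((emb f).trans (Fin.castLEEmb h)) (emb g)
  refine ⟨(Fin.castLEEmb h).trans σ.toEmbedding, hom_ext fun x => ?_⟩
  exact congrArg (fun φ : Fin a.n ↪ Fin c.n => φ x) hσ

end FI

/-! ### The shift on `FI^m` and its comma categories. -/

namespace FIPow

variable {m : ℕ}

/-- The functor `n ↦ n + (1, …, 1)` on `FI^m`. -/
def shift (m : ℕ) : FIPow m ⥤ FIPow m := Functor.pi fun _ => FI.shift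

/-- The inclusion `n ⟶ n + (1, …, 1)` missing the new elements. -/
def unit (m : ℕ) : 𝟭 (FIPow m) ⟶ shift m where
  app a j := FI.unit.app (a j)
  naturality _ _ f := funext fun j => FI.unit.naturality (f j)

theorem exists_comp_eq {a b c : FIPow m} (f : a ⟶ b) (g : a ⟶ c) (h : ∀ j, (b j).n ≤ (c j).n) :
    ∃ g' : b ⟶ c, f ≫ g' = g := by
  choose g' hg' using fun j => FI.exists_comp_eq (f j) (g j) (h j)
  exact ⟨g', funext hg'⟩

theorem unit_app_injective {a b : FIPow m} {f g : a ⟶ b}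
    (h : f ≫ (unit m).app b = g ≫ (unit m).app b) : f = g :=
  funext fun j => (cancel_mono (FI.unit.app (b j))).1 (congrFun h j)

theorem exists_comp_unit_comp_shift_map_iff {a b c : FIPow m} (f : a ⟶ (shift m).obj b)
    (h : b ⟶ c) : (∃ g : a ⟶ c, g ≫ (unit m).app c = f ≫ (shift m).map h) ↔
      ∃ g : a ⟶ b, g ≫ (unit m).app b = f := by
  constructor
  · rintro ⟨g, hg⟩
    choose g' hg' using fun j =>
      (FI.exists_comp_unit_comp_shift_map_iff (f j) (h j)).1 ⟨g j, congrFun hg j⟩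
    exact ⟨g', funext hg'⟩
  · rintro ⟨g, rfl⟩
    exact ⟨g ≫ h, by rw [Category.assoc, Category.assoc, ← (unit m).naturality]; rfl⟩

theorem exists_isIso_shift {x : FIPow m} (e : ∀ j, Fin (x j).n) :
    ∃ (b : FIPow m) (φ : ∀ j, FI.shift.obj (b j) ⟶ x j),
      ∀ j, IsIso (φ j) ∧ FI.emb (φ j) (FI.base (b j)) = e j := by
  choose b φ h using fun j => FI.exists_isIso_shift (e j)
  exact ⟨b, φ, h⟩

/-- The complement of a point `e` of `x`. -/
noncomputable def compl {x : FIPow m} (e : ∀ j, Fin (x j).n) : FIPow m :=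
  (exists_isIso_shift e).choose

/-- The isomorphism between `x` and the complement of `e` with a point added. -/
noncomputable def complHom {x : FIPow m} (e : ∀ j, Fin (x j).n) (j : Fin m) :
    FI.shift.obj (compl e j) ⟶ x j :=
  (exists_isIso_shift e).choose_spec.choose j

instance {x : FIPow m} (e : ∀ j, Fin (x j).n) (j : Fin m) : IsIso (complHom e j) :=
  ((exists_isIso_shift e).choose_spec.choose_spec j).1

theorem emb_complHom_base {x : FIPow m} (e : ∀ j, Fin (x j).n) (j : Fin m) :
    FI.emb (complHom e j) (FI.base _) = e j :=
  ((exists_isIso_shift e).choose_spec.choose_spec j).2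

/-- The complement of a point of `x`, as an object over `x`. -/
noncomputable def pointed {x : FIPow m} (e : ∀ j, Fin (x j).n) :
    CostructuredArrow (shift m) x :=
  CostructuredArrow.mk (Y := compl e) (complHom e)

/-- The components of the structure morphism of an object over `x`. -/
def component {x : FIPow m} (d : CostructuredArrow (shift m) x) (j : Fin m) :
    FI.shift.obj (d.left j) ⟶ x j := d.hom j

/-- A morphism from a shifted object to `x` marks the images of the new elements, and its
restriction to the old ones lands in the complement of these points. -/
theorem nonempty_hom_pointed {x : FIPow m} (d : CostructuredArrow (shift m) x) :
    Nonempty (d ⟶ pointed fun j => FI.emb (component d j) (FI.base _)) := by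
  choose g hg using fun j => FI.exists_shift_map_comp_eq
    (complHom (fun j => FI.emb (component d j) (FI.base _)) j) (component d j)
    (emb_complHom_base (fun j => FI.emb (component d j) (FI.base _)) j).symm
  exact ⟨CostructuredArrow.homMk g (funext hg)⟩

theorem shift_map_left_comp_complHom {x : FIPow m} {d : CostructuredArrow (shift m) x}
    {e : ∀ j, Fin (x j).n} (f : d ⟶ pointed e) (j : Fin m) :
    FI.shift.map (f.left j) ≫ complHom e j = component d j :=
  congrFun (CostructuredArrow.w f) j

theorem emb_component_base {x : FIPow m} {d : CostructuredArrow (shift m) x}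
    {e : ∀ j, Fin (x j).n} (f : d ⟶ pointed e) (j : Fin m) :
    FI.emb (component d j) (FI.base _) = e j := by
  rw [← shift_map_left_comp_complHom f j]
  exact emb_complHom_base e j

instance {x : FIPow m} (d : CostructuredArrow (shift m) x) (e : ∀ j, Fin (x j).n) :
    Subsingleton (d ⟶ pointed e) where
  allEq f g := by
    ext : 1
    refine funext fun j => FI.shift.map_injective ((cancel_mono (complHom e j)).1 ?_)
    exact (shift_map_left_comp_complHom f j).trans (shift_map_left_comp_complHom g j).symm

/-- An object `d` over `x` maps to `pointed e` for exactly one `e`, the tuple of points it marks,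
and by exactly one morphism. Colimits over this comma category are therefore finite coproducts
indexed by the tuples of points of `x`. -/
instance (x : FIPow m) :
    (Discrete.functor (pointed : (∀ j, Fin (x j).n) → CostructuredArrow (shift m) x)).Final where
  out d := by
    obtain ⟨f⟩ := nonempty_hom_pointed d
    have : Nonempty (StructuredArrow d (Discrete.functor
      (pointed : (∀ j, Fin (x j).n) → CostructuredArrow (shift m) x))) :=
      ⟨StructuredArrow.mk (Y := Discrete.mk _) f⟩
    refine zigzag_isConnected fun X Y => ?_
    obtain ⟨⟨⟨⟩⟩, ⟨e⟩, f⟩ := X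
    obtain ⟨⟨⟨⟩⟩, ⟨e'⟩, f'⟩ := Y
    obtain rfl : e = e' := funext fun j =>
      (emb_component_base (show d ⟶ pointed e from f) j).symm.trans
        (emb_component_base (show d ⟶ pointed e' from f') j)
    obtain rfl : f = f' := Subsingleton.elim (α := (d ⟶ pointed e)) f f'
    exact Zigzag.refl _

end FIPow

/-! ### Left Kan extension and exactness in functor categories. -/

namespace CategoryTheory.Functor

universe v₁ v₂ v₃ u₁ u₂ u₃

variable {C : Type u₁} [Category.{v₁} C] {D : Type u₂} [Category.{v₂} D] (L : C ⥤ D)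
  (E : Type u₃) [Category.{v₃} E]

/-- Left Kan extension preserves monomorphisms if the colimits that compute it do. -/
theorem lan_preservesMonomorphisms [HasPullbacks E]
    [∀ X, HasColimitsOfShape (CostructuredArrow L X) E]
    [∀ X, (colim : (CostructuredArrow L X ⥤ E) ⥤ E).PreservesMonomorphisms] :
    (L.lan : (C ⥤ E) ⥤ (D ⥤ E)).PreservesMonomorphisms where
  preserves {G₁ G₂} φ hφ := by
    rw [NatTrans.mono_iff_mono_app]
    intro X
    have : Mono (whiskerLeft (CostructuredArrow.proj L X) φ) := by
      rw [NatTrans.mono_iff_mono_app] at hφ ⊢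
      exact fun Y => hφ _
    refine colim.map_mono' (whiskerLeft (CostructuredArrow.proj L X) φ)
      (isPointwiseLeftKanExtensionLeftKanExtensionUnit L G₁ X)
      (isPointwiseLeftKanExtensionLeftKanExtensionUnit L G₂ X) ((L.lan.map φ).app X) fun T => ?_
    have h : φ.app T.left ≫ (L.lanUnit.app G₂).app T.left =
        (L.lanUnit.app G₁).app T.left ≫ (L.lan.map φ).app (L.obj T.left) :=
      congr_app (L.lanUnit.naturality φ) T.left
    change ((L.lanUnit.app G₁).app T.left ≫ (L.lan.obj G₁).map T.hom) ≫ (L.lan.map φ).app X =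
      φ.app T.left ≫ (L.lanUnit.app G₂).app T.left ≫ (L.lan.obj G₂).map T.hom
    rw [reassoc_of% h, Category.assoc, NatTrans.naturality]

end CategoryTheory.Functor

/-- Exactness in a functor category is tested objectwise. -/
theorem CategoryTheory.ShortComplex.exact_iff_evaluation {J : Type*} [Category* J] {A : Type*}
    [Category* A] [Abelian A] (S : ShortComplex (J ⥤ A)) :
    S.Exact ↔ ∀ j, (S.map ((evaluation J A).obj j)).Exact := by
  rw [S.exact_iff_isZero_homology, Functor.isZero_iff]
  refine forall_congr' fun j => ?_
  rw [exact_iff_isZero_homology]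
  exact (S.mapHomologyIso ((evaluation J A).obj j)).isZero_iff.symm

/-! ### The shift of `FI^m`-modules and its interaction with torsion. -/

namespace FIModule

variable (k : Type u) [CommRing k] (m : ℕ)

/-- The shift functor `V ↦ V_{• + (1, …, 1)}`. -/
abbrev shift : FIModule k m ⥤ FIModule k m :=
  (Functor.whiskeringLeft _ _ _).obj (FIPow.shift m)

/-- The natural map from a module to its shift. -/
def shiftUnit : 𝟭 (FIModule k m) ⟶ shift k m where
  app V :=
    { app n := V.map ((FIPow.unit m).app n)
      naturality n n' f := by
        change V.map f ≫ V.map _ = V.map _ ≫ V.map _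
        rw [← V.map_comp, ← V.map_comp]
        exact congrArg V.map ((FIPow.unit m).naturality f) }
  naturality V V' φ := by
    ext n : 2
    exact (φ.naturality _).symm

instance : (shift k m).Additive where

instance : PreservesFiniteLimits (shift k m) := ⟨fun _ _ _ => inferInstance⟩

instance : PreservesFiniteColimits (shift k m) := ⟨fun _ _ _ => inferInstance⟩

/-- A right adjoint preserves injectives if its left adjoint preserves monomorphisms. Here the left
adjoint is left Kan extension, whose values are coproducts over the tuples of points, and these are
exact. -/
instance : (shift k m).PreservesInjectiveObjects := by
  have (x : FIPow m) : HasColimitsOfShape (CostructuredArrow (FIPow.shift m) x) (ModuleCat.{u} k) :=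
    inferInstance
  have (x : FIPow m) : HasExactColimitsOfShape (CostructuredArrow (FIPow.shift m) x)
      (ModuleCat.{u} k) :=
    hasExactColimitsOfShape_of_final _ (Discrete.functor (FIPow.pointed (x := x)))
  have := Functor.lan_preservesMonomorphisms (FIPow.shift m) (ModuleCat.{u} k)
  exact Functor.preservesInjectiveObjects_of_adjunction_of_preservesMonomorphisms
    ((FIPow.shift m).lanAdjunction (ModuleCat.{u} k))

variable {k m}

theorem isTorsionElt_shift_iff [NeZero m] (V : FIModule k m) (n : FIPow m)
    (v : V.obj ((FIPow.shift m).obj n)) :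
    IsTorsionElt ((shift k m).obj V) n v ↔ IsTorsionElt V ((FIPow.shift m).obj n) v := by
  constructor
  · rintro ⟨r, f, ⟨j, hj⟩, hv⟩
    refine ⟨_, (FIPow.shift m).map f, ⟨j, ?_⟩, hv⟩
    rw [FI.not_isIso_iff] at hj
    exact FI.not_isIso_of_lt _ (Nat.succ_lt_succ hj)
  · rintro ⟨r, f, -, hv⟩
    -- `N` is large enough that the shift of `g` factors through `f`, hence kills `v`; the extra `1`
    -- makes `g` non-invertible.
    let N : FIPow m := fun j => ⟨(n j).n + (r j).n + 1⟩
    let g : n ⟶ N := fun j => (Fin.castLEEmb (by simp only [N]; omega) : Fin (n j).n ↪ Fin (N j).n)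
    obtain ⟨h, hh⟩ := FIPow.exists_comp_eq f ((FIPow.shift m).map g) fun j => by
      change (r j).n ≤ (n j).n + (r j).n + 1 + 1
      omega
    refine ⟨N, g, ⟨0, FI.not_isIso_of_lt _ ?_⟩, ?_⟩
    · simp only [N]
      omega
    · change V.map ((FIPow.shift m).map g) v = 0
      rw [← hh, V.map_comp, ModuleCat.comp_apply, hv, map_zero]

theorem isTorsionElt_of_mono {V V' : FIModule k m} (φ : V ⟶ V') [Mono φ] {n : FIPow m}
    {v : V.obj n} (hv : IsTorsionElt V' n (φ.app n v)) : IsTorsionElt V n v := by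
  obtain ⟨r, f, hf, h₀⟩ := hv
  refine ⟨r, f, hf, (ModuleCat.mono_iff_injective _).1
    ((NatTrans.mono_iff_mono_app φ).1 inferInstance r) ?_⟩
  rw [← ModuleCat.comp_apply, φ.naturality, ModuleCat.comp_apply, h₀, map_zero]

theorem isTorsionElt_torsion [NeZero m] (V : FIModule k m) (n : FIPow m)
    (v : (torsion V).obj n) : IsTorsionElt (torsion V) n v := by
  obtain ⟨r, f, hf, h₀⟩ := v.2
  exact ⟨r, f, hf, Subtype.ext h₀⟩

/-- If the natural map to the shift is a monomorphism, the module is torsion-free. -/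
theorem eq_zero_of_isTorsionElt (V : FIModule k m) [Mono ((shiftUnit k m).app V)]
    {n : FIPow m} {v : V.obj n} (hv : IsTorsionElt V n v) : v = 0 := by
  have inj (n : FIPow m) : Function.Injective (V.map ((FIPow.unit m).app n)) := by
    have h := (NatTrans.mono_iff_mono_app ((shiftUnit k m).app V)).1 inferInstance n
    exact (ModuleCat.mono_iff_injective _).1 h
  -- Iterating the unit embeds `V_n` into the value at an object with every coordinate at least `N`.
  -- Once `N` bounds all coordinates of `r`, such a `g` factors through the map `f` that kills `v`.
  have key (N : ℕ) : ∃ (c : FIPow m) (g : n ⟶ c),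
      (∀ j, N ≤ (c j).n) ∧ Function.Injective (V.map g) := by
    induction N with
    | zero => exact ⟨n, 𝟙 n, fun j => Nat.zero_le _, by simpa using Function.injective_id⟩
    | succ N ih =>
      obtain ⟨c, g, hc, hg⟩ := ih
      refine ⟨_, g ≫ (FIPow.unit m).app c, fun j => Nat.succ_le_succ (hc j), ?_⟩
      have h : V.map (g ≫ (FIPow.unit m).app c) = V.map g ≫ V.map ((FIPow.unit m).app c) :=
        V.map_comp _ _
      rw [h]
      exact (inj _).comp hg
  obtain ⟨r, f, -, hv⟩ := hv
  obtain ⟨c, g, hc, hg⟩ := key (∑ j, (r j).n)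
  obtain ⟨h, rfl⟩ := FIPow.exists_comp_eq f g fun j =>
    (Finset.single_le_sum (f := fun j => (r j).n) (fun _ _ => Nat.zero_le _)
      (Finset.mem_univ j)).trans (hc j)
  refine hg ?_
  rw [V.map_comp, ModuleCat.comp_apply, hv, map_zero, map_zero]

variable (k m) [NeZero m]

/-- The torsion functor commutes with the shift. -/
def torsionShiftIso : shift k m ⋙ torsionFunctor k m ≅ torsionFunctor k m ⋙ shift k m :=
  NatIso.ofComponents
    (fun V => NatIso.ofComponents
      (fun n => (LinearEquiv.ofEq (torsionSubmodule ((shift k m).obj V) n)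
        (torsionSubmodule V ((FIPow.shift m).obj n))
        (Submodule.ext fun v => isTorsionElt_shift_iff V n v)).toModuleIso)
      (fun _ => rfl))
    (fun _ => rfl)

instance : PreservesFiniteLimits (torsionFunctor k m) := by
  rw [Functor.preservesFiniteLimits_iff_forall_exact_map_and_mono]
  intro S hS
  have := hS.mono_f
  have inj (n : FIPow m) : Function.Injective (S.f.app n) :=
    (ModuleCat.mono_iff_injective _).1 ((NatTrans.mono_iff_mono_app S.f).1 inferInstance n)
  constructor
  · rw [ShortComplex.exact_iff_evaluation]
    intro n
    rw [ShortComplex.moduleCat_exact_iff]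
    rintro ⟨v, hv⟩ hv₀
    obtain ⟨w, rfl⟩ := (ShortComplex.moduleCat_exact_iff _).1
      ((ShortComplex.exact_iff_evaluation S).1 hS.exact n) v (congrArg Subtype.val hv₀)
    exact ⟨⟨w, isTorsionElt_of_mono S.f hv⟩, rfl⟩
  · rw [NatTrans.mono_iff_mono_app]
    intro n
    rw [ModuleCat.mono_iff_injective]
    exact fun v w h => Subtype.ext (inj n (congrArg Subtype.val h))

theorem mono_shiftUnit_localCohomology (V : FIModule k m) [IsSplitMono ((shiftUnit k m).app V)]
    (i : ℕ) : Mono ((shiftUnit k m).app ((localCohomology k m i).obj V)) :=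
  mono_app_rightDerived (torsionFunctor k m) (shift k m) (shiftUnit k m) (torsionShiftIso k m)
    (fun _ => rfl) V i

/-- Torsion passes to submodules and quotients, and this module is the homology of a complex of
torsion modules. -/
theorem isTorsionElt_localCohomology (V : FIModule k m) (i : ℕ) (n : FIPow m)
    (v : ((localCohomology k m i).obj V).obj n) : IsTorsionElt _ n v := by
  let I := injectiveResolution V
  let K := ((torsionFunctor k m).mapHomologicalComplex (ComplexShape.up ℕ)).obj I.cocomplex
  have hX (w : (K.X i).obj n) : IsTorsionElt (K.X i) n w := isTorsionElt_torsion _ n w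
  have hc (w : (K.cycles i).obj n) : IsTorsionElt (K.cycles i) n w :=
    isTorsionElt_of_mono (K.iCycles i) (hX _)
  have hh (w : (K.homology i).obj n) : IsTorsionElt (K.homology i) n w := by
    obtain ⟨w, rfl⟩ := (ModuleCat.epi_iff_surjective _).1
      ((NatTrans.epi_iff_epi_app (K.homologyπ i)).1 inferInstance n) w
    exact (hc w).app _
  exact isTorsionElt_of_mono (I.isoRightDerivedObj (torsionFunctor k m) i).hom (hh _)

theorem isZero_localCohomology_of_isSplitMono (V : FIModule k m)
    [IsSplitMono ((shiftUnit k m).app V)] (i : ℕ) : IsZero ((localCohomology k m i).obj V) := by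
  have := mono_shiftUnit_localCohomology k m V i
  rw [Functor.isZero_iff]
  intro n
  refine @ModuleCat.isZero_of_subsingleton _ _ _ ⟨fun v w => ?_⟩
  rw [eq_zero_of_isTorsionElt _ (isTorsionElt_localCohomology k m V i n v),
    eq_zero_of_isTorsionElt _ (isTorsionElt_localCohomology k m V i n w)]

end FIModule

/-! ### The splitting for induced modules. -/

namespace FIModule

open FIPow TensorProduct

section Retraction

variable {k : Type u} [CommRing k] {m : ℕ}

open Classical in
/-- The basis element of the morphism `g` if `f` factors as `g` followed by the inclusion
`n ⟶ n + (1, …, 1)`, and zero otherwise. -/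
noncomputable def restrictBasis (k : Type u) [CommRing k] {r n : FIPow m}
    (f : r ⟶ (FIPow.shift m).obj n) : (r ⟶ n) →₀ k :=
  if h : ∃ g : r ⟶ n, g ≫ (unit m).app n = f then Finsupp.single h.choose 1 else 0

theorem restrictBasis_comp_unit {r n : FIPow m} (g : r ⟶ n) :
    restrictBasis k (g ≫ (unit m).app n) = Finsupp.single g 1 := by
  have h : ∃ g' : r ⟶ n, g' ≫ (unit m).app n = g ≫ (unit m).app n := ⟨g, rfl⟩
  rw [restrictBasis, dif_pos h, unit_app_injective h.choose_spec]

theorem restrictBasis_of_not_exists {r n : FIPow m} {f : r ⟶ (FIPow.shift m).obj n}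
    (h : ¬ ∃ g : r ⟶ n, g ≫ (unit m).app n = f) : restrictBasis k f = 0 :=
  dif_neg h

/-- Naturality of the retraction on basis elements: the morphisms sent to zero stay so after
composing with a shifted morphism. -/
theorem restrictBasis_comp_shift_map {r n n' : FIPow m} (f : r ⟶ (FIPow.shift m).obj n)
    (h : n ⟶ n') : restrictBasis k (f ≫ (FIPow.shift m).map h) =
      Finsupp.mapDomain (fun g => g ≫ h) (restrictBasis k f) := by
  by_cases hf : ∃ g : r ⟶ n, g ≫ (unit m).app n = f
  · obtain ⟨g, rfl⟩ := hf
    have e : (g ≫ (unit m).app n) ≫ (FIPow.shift m).map h = (g ≫ h) ≫ (unit m).app n' := by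
      rw [Category.assoc, Category.assoc, ← (unit m).naturality]
      rfl
    rw [e, restrictBasis_comp_unit, restrictBasis_comp_unit, Finsupp.mapDomain_single]
  · rw [restrictBasis_of_not_exists hf, restrictBasis_of_not_exists, Finsupp.mapDomain_zero]
    rwa [exists_comp_unit_comp_shift_map_iff]

theorem isIso_permHom {r : FIPow m} (σ : SymGroup r) : IsIso (permHom σ) :=
  ⟨permHom σ⁻¹, funext fun j => FI.hom_ext fun x => (σ j).symm_apply_apply x,
    funext fun j => FI.hom_ext fun x => (σ j).apply_symm_apply x⟩

/-- Permuting the source does not change the image, hence not whether the new points are missed.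
This equivariance lets the retraction descend to the tensor product over `k[𝔖_r]`. -/
theorem restrictBasis_permHom_comp {r n : FIPow m} (σ : SymGroup r)
    (f : r ⟶ (FIPow.shift m).obj n) : restrictBasis k (permHom σ ≫ f) =
      Finsupp.mapDomain (fun g => permHom σ ≫ g) (restrictBasis k f) := by
  have := isIso_permHom σ
  by_cases hf : ∃ g : r ⟶ n, g ≫ (unit m).app n = f
  · obtain ⟨g, rfl⟩ := hf
    have e : permHom σ ≫ g ≫ (unit m).app n = (permHom σ ≫ g) ≫ (unit m).app n :=
      (Category.assoc _ _ _).symm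
    rw [e, restrictBasis_comp_unit, restrictBasis_comp_unit, Finsupp.mapDomain_single]
  · rw [restrictBasis_of_not_exists hf, restrictBasis_of_not_exists, Finsupp.mapDomain_zero]
    rintro ⟨g, hg⟩
    exact hf ⟨inv (permHom σ) ≫ g, (Category.assoc _ _ _).trans ((IsIso.inv_comp_eq _).2 hg)⟩

variable {r : FIPow m} {W : Type u} [AddCommGroup W] [Module k W]
  (ρ : Representation k (SymGroup r) W)

/-- The map `k[Hom(r, n + (1, …, 1))] ⊗ W ⟶ k[Hom(r, n)] ⊗ W` given by `restrictBasis`. -/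
noncomputable def retractionAux (r : FIPow m) (W : Type u) [AddCommGroup W] [Module k W]
    (n : FIPow m) :
    ((r ⟶ (FIPow.shift m).obj n) →₀ k) ⊗[k] W →ₗ[k] ((r ⟶ n) →₀ k) ⊗[k] W :=
  TensorProduct.map (Finsupp.linearCombination k (restrictBasis k)) LinearMap.id

theorem retractionAux_single_tmul {n : FIPow m} (f : r ⟶ (FIPow.shift m).obj n) (w : W) :
    retractionAux r W n (Finsupp.single f (1 : k) ⊗ₜ w) = restrictBasis k f ⊗ₜ w := by
  simp [retractionAux]

theorem mapDomain_permHom_sub_mem_inducedRel {n : FIPow m} (σ : SymGroup r) (x : (r ⟶ n) →₀ k)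
    (w : W) : Finsupp.mapDomain (fun g => permHom σ ≫ g) x ⊗ₜ[k] w - x ⊗ₜ[k] ρ σ w ∈
      inducedRel ρ n := by
  induction x using Finsupp.induction_linear with
  | zero => simp
  | add x y hx hy =>
    rw [Finsupp.mapDomain_add, TensorProduct.add_tmul, TensorProduct.add_tmul, add_sub_add_comm]
    exact add_mem hx hy
  | single g c =>
    have h := (inducedRel ρ n).smul_mem c (Submodule.subset_span ⟨g, σ, w, rfl⟩)
    rw [smul_sub, TensorProduct.smul_tmul', TensorProduct.smul_tmul', Finsupp.smul_single,
      Finsupp.smul_single, smul_eq_mul, mul_one] at h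
    rwa [Finsupp.mapDomain_single]

theorem inducedRel_le_comap_retractionAux (n : FIPow m) :
    inducedRel ρ ((FIPow.shift m).obj n) ≤ (inducedRel ρ n).comap (retractionAux r W n) := by
  refine Submodule.span_le.2 ?_
  rintro _ ⟨f, σ, w, rfl⟩
  change retractionAux r W n _ ∈ inducedRel ρ n
  rw [map_sub, retractionAux_single_tmul, retractionAux_single_tmul, restrictBasis_permHom_comp]
  exact mapDomain_permHom_sub_mem_inducedRel ρ σ _ w

theorem induced_obj_hom_ext {n : FIPow m} {M : ModuleCat.{u} k}
    {φ ψ : (induced ρ).obj n ⟶ M}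
    (h : ∀ (f : r ⟶ n) (w : W), φ (Submodule.Quotient.mk (Finsupp.single f (1 : k) ⊗ₜ[k] w)) =
      ψ (Submodule.Quotient.mk (Finsupp.single f (1 : k) ⊗ₜ[k] w))) : φ = ψ := by
  ext : 1
  refine Submodule.linearMap_qext _ (TensorProduct.ext (Finsupp.lhom_ext' fun f => ?_))
  refine LinearMap.ext_ring (LinearMap.ext fun w => ?_)
  exact h f w

/-- The retraction of an induced module's natural map to its shift. -/
noncomputable def retraction : (shift k m).obj (induced ρ) ⟶ induced ρ where
  app n := ModuleCat.ofHom (Submodule.mapQ _ _ (retractionAux r W n)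
    (inducedRel_le_comap_retractionAux ρ n))
  naturality n n' h := by
    refine induced_obj_hom_ext ρ fun f w => ?_
    change Submodule.Quotient.mk (retractionAux r W n' (inducedMapAux r W _ _)) =
      Submodule.Quotient.mk (inducedMapAux r W h (retractionAux r W n _))
    congr 1
    have e : inducedMapAux r W ((FIPow.shift m).map h) (Finsupp.single f (1 : k) ⊗ₜ[k] w) =
      Finsupp.single (f ≫ (FIPow.shift m).map h) 1 ⊗ₜ[k] w := by
      simp [inducedMapAux, Finsupp.mapDomain_single]
    rw [e, retractionAux_single_tmul, retractionAux_single_tmul, restrictBasis_comp_shift_map]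
    rfl

theorem shiftUnit_app_comp_retraction :
    (shiftUnit k m).app (induced ρ) ≫ retraction ρ = 𝟙 (induced ρ) := by
  ext n : 2
  refine induced_obj_hom_ext ρ fun f w => ?_
  change Submodule.Quotient.mk (retractionAux r W n (inducedMapAux r W ((unit m).app n) _)) =
    Submodule.Quotient.mk _
  congr 1
  have e : inducedMapAux r W ((unit m).app n) (Finsupp.single f (1 : k) ⊗ₜ[k] w) =
    Finsupp.single (f ≫ (unit m).app n) 1 ⊗ₜ[k] w := by
    simp [inducedMapAux, Finsupp.mapDomain_single]
  refine (congrArg (retractionAux r W n) e).trans ?_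
  rw [retractionAux_single_tmul, restrictBasis_comp_unit]

end Retraction

/-! ### Vanishing for induced and semi-induced modules. -/

variable {k : Type u} [CommRing k] {m : ℕ} [NeZero m]

theorem IsInduced.isZero_localCohomology {V : FIModule k m} (hV : V.IsInduced) (i : ℕ) :
    IsZero ((localCohomology k m i).obj V) := by
  obtain ⟨r, W, _, _, ρ, ⟨e⟩⟩ := hV
  have : IsSplitMono ((shiftUnit k m).app (induced ρ)) :=
    ⟨⟨⟨retraction ρ, shiftUnit_app_comp_retraction ρ⟩⟩⟩
  exact (isZero_localCohomology_of_isSplitMono k m (induced ρ) i).of_iso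
    ((localCohomology k m i).mapIso e)

theorem IsSemiInduced.isZero_localCohomology {V : FIModule k m} (hV : V.IsSemiInduced) (i : ℕ) :
    IsZero ((localCohomology k m i).obj V) := by
  obtain ⟨l, F, h₀, h₁, hF⟩ := hV
  have key (j : Fin (l + 1)) : IsZero ((localCohomology k m i).obj (F j : FIModule k m)) := by
    induction j using Fin.induction with
    | zero =>
      rw [h₀]
      have hz : IsZero ((⊥ : Subobject V) : FIModule k m) :=
        (isZero_zero _).of_iso Subobject.botCoeIsoZero
      -- On the zero module the zero map is a retraction, so the criterion for split modules also
      -- covers the bottom of the filtration.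
      have : IsSplitMono ((shiftUnit k m).app ((⊥ : Subobject V) : FIModule k m)) :=
        ⟨⟨⟨0, hz.eq_of_src _ _⟩⟩⟩
      exact isZero_localCohomology_of_isSplitMono k m _ i
    | succ j ih =>
      obtain ⟨h, hj⟩ := hF j
      exact ShortComplex.ShortExact.isZero_rightDerived_X₂ (torsionFunctor k m) i
        (ShortComplex.mk _ _ (cokernel.condition (Subobject.ofLE _ _ h)))
        { exact := ShortComplex.exact_cokernel _
          mono_f := inferInstanceAs (Mono (Subobject.ofLE _ _ h))
          epi_g := inferInstanceAs (Epi (cokernel.π _)) } ih (hj.isZero_localCohomology i)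
  have e : (F (Fin.last l) : FIModule k m) ≅ V := by
    rw [h₁]
    exact asIso (⊤ : Subobject V).arrow
  exact (key (Fin.last l)).of_iso ((localCohomology k m i).mapIso e.symm)

end FIModule

theorem mainTheorem7 {k : Type u} [CommRing k] [IsNoetherianRing k] {m : ℕ} [NeZero m]
    (V : FIModule k m) (hV : V.IsSemiInduced) (i : ℕ) :
    CategoryTheory.Limits.IsZero ((FIModule.localCohomology k m i).obj V) :=
  hV.isZero_localCohomology i
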